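/- Let $M>0$ and $|a|\le M$, and consider the Kerr metric in Boyer–Lindquist coordinates $(t,r,\theta,\phi)$, $$\mathbf g=-\frac{\Delta-a^2\sin^2\theta}{\Sigma}dt^2-\frac{a\sin^2\theta\,(r^2+a^2-\Delta)}{\Sigma}(dt\otimes d\phi+d\phi\otimes dt)+\frac{\Sigma}{\Delta}dr^2+\Sigma\,d\theta^2+R^2\sin^2\theta\,d\phi^2,$$ with $\Sigma=r^2+a^2\cos^2\theta$, $\Delta=r^2+a^2-2Mr$, $\Sigma R^2=(r^2+a^2)^2-\Delta a^2\sin^2\theta$, $R>0$, in the region $r>M+\sqrt{M^2-a^2}$, $0<\theta<\pi$. Put $\omega_B=\dfrac{2Mar}{\Sigma R^2}$ and $\Omega=\sqrt{\Delta/R^2}$. Let $r_*(r,\theta)$ and $\theta_*(r,\theta)\in(0,\pi)$ be a pair of Israel–Pretorius coordinates, of class $C^2$ on an open set $U$ of values $(r,\theta)$ in this region: $u=\frac12(t-r_*)$ and $\underline u=\frac12(t+r_*)$ solve the eikonal equation $g^{\mu\nu}\partial_\mu w\,\partial_\nu w=0$; $\partial_r r_*>0$; $(\partial_\theta r_*)^2=a^2(\lambda-\sin^2\theta)$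 with $\lambda=\sin^2\theta_*$; $g^{\mu\nu}\partial_\mu r_*\,\partial_\nu\theta_*=0$; and $\partial_\theta\theta_*\neq0$. Put $Q=\sqrt{(r^2+a^2)^2-a^2\lambda\Delta}$. With $\partial_u,\partial_{\underline u},\partial_{\theta_*},\partial_\phi$ the coordinate vector fields of $(u,\underline u,\theta_*,\phi)$, let $$e_3=\frac1\Omega(\partial_u+\omega_B\partial_\phi),\quad e_4=\frac1\Omega(\partial_{\underline u}+\omega_B\partial_\phi),\quad e_\lambda=\frac{\partial_{\theta_*}}{|\partial_{\theta_*}|_{\mathbf g}},\quad e_\phi=\frac1{R\sin\theta}\partial_\phi .$$ With $\mathbf D$ the Levi-Civita connection of $\mathbf g$ and $a,b\in\{\lambda,\phi\}$ as frame indices, let $\chi(e_a,e_b)=\mathbf g(\mathbf D_{e_a}e_4,e_b)$, $\underline\chi(e_a,e_b)=\mathbf g(\mathbf D_{e_a}e_3,e_b)$, $\zeta(e_a)=\frac12\mathbf g(\mathbf D_{e_a}e_4,e_3)$, $\omega=-\frac14\mathbf g(\mathbf D_{e_4}e_3,e_4)$, $\underline\omega=-\frac14\mathbf g(\mathbf D_{e_3}e_4,e_3)$,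 $\mathrm{tr}\chi=\sum_a\chi(e_a,e_a)$, $\mathrm{tr}\underline\chi=\sum_a\underline\chi(e_a,e_a)$. Then at every point with $(r,\theta)\in U$: $$\Omega(\chi+\underline\chi)(e_a,e_b)=e_\lambda(\omega_B)\,R\sin\theta\,(\delta_{b\phi}\delta_{a\lambda}+\delta_{a\phi}\delta_{b\lambda}),$$ $$\zeta(e_a)=\Big(-\frac{QR\sin\theta}{2\Sigma}\,\partial_r\omega_B\Big)\delta_{a\phi},\qquad \omega+\underline\omega=0,\qquad \mathrm{tr}\chi+\mathrm{tr}\underline\chi=0,$$ where $\partial_r\omega_B$ is the derivative of $\omega_B$ as a function of $(r,\theta_*)$, i.e. with respect to $r$ at constant $\theta_*$. -/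

import Mathlib

noncomputable section

namespace Kerr

/-! ### Lorentzian geometry in one chart of a four-dimensional spacetime -/

/-- Points of the coordinate chart, and tangent vectors through their components. -/
abbrev Vec := Fin 4 → ℝ

/-- The partial derivative `∂_i f`. -/
def partialDeriv (i : Fin 4) (f : Vec → ℝ) (x : Vec) : ℝ :=
  fderiv ℝ f x (Pi.single i 1)

/-- The derivative `v(f)` of a function in the direction of the tangent vector `v`. -/
def dirDeriv (v : Vec) (f : Vec → ℝ) (x : Vec) : ℝ :=
  fderiv ℝ f x v

/-- The scalar product `g(v, w)` at the point `x`, for a metric given by its matrix. -/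
def pairing (g : Vec → Matrix (Fin 4) (Fin 4) ℝ) (x v w : Vec) : ℝ :=
  ∑ i, ∑ j, g x i j * v i * w j

/-- The Christoffel symbols `Γ^k_{ij}` of the Levi-Civita connection. -/
def christoffel (g : Vec → Matrix (Fin 4) (Fin 4) ℝ) (x : Vec) (k i j : Fin 4) : ℝ :=
  (1 / 2) * ∑ l, (g x)⁻¹ k l *
    (partialDeriv i (fun y => g y j l) x + partialDeriv j (fun y => g y i l) x
      - partialDeriv l (fun y => g y i j) x)

/-- The Levi-Civita covariant derivative `D_X Y` of vector fields. -/
def covDeriv (g : Vec → Matrix (Fin 4) (Fin 4) ℝ) (X Y : Vec → Vec) (x : Vec) : Vec :=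
  fun k => dirDeriv (X x) (fun y => Y y k) x + ∑ i, ∑ j, christoffel g x k i j * X x i * Y x j

/-- `g^{μν} ∂_μ v ∂_ν w`, the scalar product of the differentials of two functions. -/
def gradPairing (g : Vec → Matrix (Fin 4) (Fin 4) ℝ) (v w : Vec → ℝ) (x : Vec) : ℝ :=
  ∑ i, ∑ j, (g x)⁻¹ i j * partialDeriv i v x * partialDeriv j w x

/-- The coordinate vector field `∂/∂y^i` of a coordinate system `y = (y⁰, y¹, y², y³)`,
that is the vector `v` with `dy^j(v) = δ^j_i`. -/
def coordVec (y : Vec → Vec) (i : Fin 4) (x : Vec) : Vec :=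
  (fderiv ℝ y x).inverse (Pi.single i 1)

/-! ### Connection coefficients of a null frame -/

/-- `χ(X, Y) = g(D_X e₄, Y)`; with `e₃` in place of `e₄` it is `χ̲(X, Y)`. -/
def nullForm (g : Vec → Matrix (Fin 4) (Fin 4) ℝ) (e4 X Y : Vec → Vec) (x : Vec) : ℝ :=
  pairing g x (covDeriv g X e4 x) (Y x)

/-- The torsion `ζ(X) = ½ g(D_X e₄, e₃)`. -/
def torsion (g : Vec → Matrix (Fin 4) (Fin 4) ℝ) (e3 e4 X : Vec → Vec) (x : Vec) : ℝ :=
  (1 / 2) * pairing g x (covDeriv g X e4 x) (e3 x)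

/-- `ω = -¼ g(D_{e₄} e₃, e₄)`; with `e₃` and `e₄` exchanged it is `ω̲`. -/
def nullLapse (g : Vec → Matrix (Fin 4) (Fin 4) ℝ) (e3 e4 : Vec → Vec) (x : Vec) : ℝ :=
  -(1 / 4) * pairing g x (covDeriv g e4 e3 x) (e4 x)

/-! ### The Kerr metric in Boyer-Lindquist coordinates `x = (t, r, θ, φ)` -/

def Sigma (a : ℝ) (x : Vec) : ℝ := x 1 ^ 2 + a ^ 2 * Real.cos (x 2) ^ 2

def Delta (M a : ℝ) (x : Vec) : ℝ := x 1 ^ 2 + a ^ 2 - 2 * M * x 1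

/-- The positive function `R` with `R² = ((r² + a²)² - Δ a² sin² θ) / Σ`. -/
def bigR (M a : ℝ) (x : Vec) : ℝ :=
  √(((x 1 ^ 2 + a ^ 2) ^ 2 - Delta M a x * a ^ 2 * Real.sin (x 2) ^ 2) / Sigma a x)

def omegaB (M a : ℝ) (x : Vec) : ℝ := 2 * M * a * x 1 / (Sigma a x * bigR M a x ^ 2)

/-- The lapse `Ω = √(Δ / R²)` of the double null foliation. -/
def Omega (M a : ℝ) (x : Vec) : ℝ := √(Delta M a x / bigR M a x ^ 2)

/-- The matrix of the Kerr metric. -/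
def metric (M a : ℝ) (x : Vec) : Matrix (Fin 4) (Fin 4) ℝ :=
  let S := Sigma a x
  let D := Delta M a x
  let s := Real.sin (x 2) ^ 2
  let gtt := -((D - a ^ 2 * s) / S)
  let gtp := -(a * s * (x 1 ^ 2 + a ^ 2 - D) / S)
  let gpp := ((x 1 ^ 2 + a ^ 2) ^ 2 - D * a ^ 2 * s) / S * s
  !![gtt, 0, 0, gtp;
     0, S / D, 0, 0;
     0, 0, S, 0;
     gtp, 0, 0, gpp]

/-- The values of `(r, θ)` in the domain of outer communications, axis excluded. -/
def exterior (M a : ℝ) : Set (ℝ × ℝ) :=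
  {p | M + √(M ^ 2 - a ^ 2) < p.1 ∧ p.2 ∈ Set.Ioo 0 Real.pi}

/-! ### Israel-Pretorius coordinates and frame -/

/-- `u = (t - r_*) / 2`. -/
def uFun (rs : ℝ × ℝ → ℝ) (x : Vec) : ℝ := (x 0 - rs (x 1, x 2)) / 2

/-- `u̲ = (t + r_*) / 2`. -/
def ubFun (rs : ℝ × ℝ → ℝ) (x : Vec) : ℝ := (x 0 + rs (x 1, x 2)) / 2

/-- `r_*` and `θ_*`, functions of `(r, θ)`, form a pair of Israel-Pretorius coordinates on `U`:
`u` and `u̲` solve the eikonal equation, `r_*` increases with `r`, the separation parameter of the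
solution is `λ = sin² θ_*`, i.e. `(∂_θ r_*)² = P² = a² (λ - sin² θ)`, and `θ_*` is an angular
coordinate orthogonal to `r_*`. -/
structure IsIsraelPretorius (M a : ℝ) (U : Set (ℝ × ℝ)) (rs ths : ℝ × ℝ → ℝ) : Prop where
  isOpen : IsOpen U
  subset_exterior : U ⊆ exterior M a
  contDiffOn_rs : ContDiffOn ℝ 2 rs U
  contDiffOn_ths : ContDiffOn ℝ 2 ths U
  eikonal_u : ∀ x : Vec, (x 1, x 2) ∈ U → gradPairing (metric M a) (uFun rs) (uFun rs) x = 0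
  eikonal_ub : ∀ x : Vec, (x 1, x 2) ∈ U → gradPairing (metric M a) (ubFun rs) (ubFun rs) x = 0
  rs_increasing : ∀ p ∈ U, 0 < fderiv ℝ rs p (1, 0)
  separation : ∀ p ∈ U,
    fderiv ℝ rs p (0, 1) ^ 2 = a ^ 2 * (Real.sin (ths p) ^ 2 - Real.sin p.2 ^ 2)
  ths_mem : ∀ p ∈ U, ths p ∈ Set.Ioo 0 Real.pi
  orthogonal : ∀ x : Vec, (x 1, x 2) ∈ U →
    gradPairing (metric M a) (fun y => rs (y 1, y 2)) (fun y => ths (y 1, y 2)) x = 0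
  nondegenerate : ∀ p ∈ U, fderiv ℝ ths p (0, 1) ≠ 0

/-- `Q = √((r² + a²)² - a² λ Δ)` with `λ = sin² θ_*`. -/
def bigQ (M a : ℝ) (ths : ℝ × ℝ → ℝ) (x : Vec) : ℝ :=
  √((x 1 ^ 2 + a ^ 2) ^ 2 - a ^ 2 * Real.sin (ths (x 1, x 2)) ^ 2 * Delta M a x)

/-- The coordinates `(u, u̲, θ_*, φ)`. -/
def ipCoord (rs ths : ℝ × ℝ → ℝ) (x : Vec) : Vec :=
  ![uFun rs x, ubFun rs x, ths (x 1, x 2), x 3]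

/-- The coordinates `(t, r, θ_*, φ)`. -/
def radialCoord (ths : ℝ × ℝ → ℝ) (x : Vec) : Vec :=
  ![x 0, x 1, ths (x 1, x 2), x 3]

/-- `∂_r ω_B`, where `ω_B` is a function of `(r, θ_*)`: the derivative with respect to `r` is taken
at constant `θ_*`. -/
def omegaBr (M a : ℝ) (ths : ℝ × ℝ → ℝ) (x : Vec) : ℝ :=
  dirDeriv (coordVec (radialCoord ths) 1 x) (omegaB M a) x

/-- `e₃ = Ω⁻¹ (∂_u + ω_B ∂_φ)`. -/
def e3 (M a : ℝ) (rs ths : ℝ × ℝ → ℝ) (x : Vec) : Vec :=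
  (Omega M a x)⁻¹ •
    (coordVec (ipCoord rs ths) 0 x + omegaB M a x • coordVec (ipCoord rs ths) 3 x)

/-- `e₄ = Ω⁻¹ (∂_u̲ + ω_B ∂_φ)`. -/
def e4 (M a : ℝ) (rs ths : ℝ × ℝ → ℝ) (x : Vec) : Vec :=
  (Omega M a x)⁻¹ •
    (coordVec (ipCoord rs ths) 1 x + omegaB M a x • coordVec (ipCoord rs ths) 3 x)

/-- The frame of the spheres `S(u, u̲)`: `eS 0 = e_λ` is `∂_{θ_*}` normalised to unit length and
`eS 1 = e_φ = (R sin θ)⁻¹ ∂_φ`. -/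
def eS (M a : ℝ) (rs ths : ℝ × ℝ → ℝ) (b : Fin 2) (x : Vec) : Vec :=
  if b = 0 then
    (√(pairing (metric M a) x (coordVec (ipCoord rs ths) 2 x) (coordVec (ipCoord rs ths) 2 x)))⁻¹ •
      coordVec (ipCoord rs ths) 2 x
  else
    (bigR M a x * Real.sin (x 2))⁻¹ • coordVec (ipCoord rs ths) 3 x

/-- `χ(e_a, e_b)`. -/
def chi (M a : ℝ) (rs ths : ℝ × ℝ → ℝ) (b c : Fin 2) (x : Vec) : ℝ :=
  nullForm (metric M a) (e4 M a rs ths) (eS M a rs ths b) (eS M a rs ths c) x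

/-- `χ̲(e_a, e_b)`. -/
def chib (M a : ℝ) (rs ths : ℝ × ℝ → ℝ) (b c : Fin 2) (x : Vec) : ℝ :=
  nullForm (metric M a) (e3 M a rs ths) (eS M a rs ths b) (eS M a rs ths c) x

/-- `ζ(e_a)`. -/
def zeta (M a : ℝ) (rs ths : ℝ × ℝ → ℝ) (b : Fin 2) (x : Vec) : ℝ :=
  torsion (metric M a) (e3 M a rs ths) (e4 M a rs ths) (eS M a rs ths b) x

/-- `ω`. -/
def omega (M a : ℝ) (rs ths : ℝ × ℝ → ℝ) (x : Vec) : ℝ :=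
  nullLapse (metric M a) (e3 M a rs ths) (e4 M a rs ths) x

/-- `ω̲`. -/
def omegab (M a : ℝ) (rs ths : ℝ × ℝ → ℝ) (x : Vec) : ℝ :=
  nullLapse (metric M a) (e4 M a rs ths) (e3 M a rs ths) x

/-- `tr χ`. -/
def trChi (M a : ℝ) (rs ths : ℝ × ℝ → ℝ) (x : Vec) : ℝ := ∑ b, chi M a rs ths b b x

/-- `tr χ̲`. -/
def trChib (M a : ℝ) (rs ths : ℝ × ℝ → ℝ) (x : Vec) : ℝ := ∑ b, chib M a rs ths b b x

/-- The Kronecker symbol of the frame indices. -/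
def kron (b c : Fin 2) : ℝ := if b = c then 1 else 0

end Kerr

end

namespace Kerr

open Filter Topology

/-! Everything reduces to the second fundamental form `k` of the slices t = const. In
Boyer–Lindquist coordinates the t–φ block of the metric is -Ω² dt² + g_φφ (dφ - ω_B dt)², so T =
Ω⁻¹(∂_t + ω_B ∂_φ) is the unit normal of the slices. The eikonal equation says that n = Ω grad r_*
is a unit vector, and it is tangent to the slices. Since ∂_u and ∂_u̲ are ∂_t ∓ Ω² grad r_*, the
null frame is e₃ = T - n, e₄ = T + n (`e3_eq`, `e4_eq`).

With k(X, Z) = g(D_X T, Z), metric compatibility and orthonormality of T, n give χ + χ̲ = 2k, ζ =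
-k(·, n) and ω + ω̲ = -k(n, n); only T is differentiated in the end.

Because the metric depends on (r, θ) alone, only the variation of the shift ω_B contributes to k:
k(X, Z) = (2Ω)⁻¹ g_φφ (X(ω_B) Z^φ + Z(ω_B) X^φ), by `pairing_covDeriv_staticField`. Now e_λ and n
have no φ component and e_φ annihilates ω_B, so only the λφ and φn entries survive. The value of ζ
needs n(ω_B): since grad r_* is orthogonal to grad θ_*, it is a multiple of ∂_r at constant θ_*
(`dirDeriv_gradRs_omegaB`). -/

theorem fderiv_apply_eq_sum (f : Vec → ℝ) (x v : Vec) :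
    fderiv ℝ f x v = ∑ i, v i * partialDeriv i f x := by
  conv_lhs => rw [← Finset.univ_sum_single v]
  rw [map_sum]
  refine Finset.sum_congr rfl fun i _ => ?_
  have : (Pi.single i (v i) : Vec) = v i • Pi.single i 1 := by
    rw [← Pi.single_smul, smul_eq_mul, mul_one]
  rw [this, map_smul, smul_eq_mul, partialDeriv]

/-! ### Linearity of the scalar product and of the connection -/

theorem pairing_add_left (g : Vec → Matrix (Fin 4) (Fin 4) ℝ) (x v v' w : Vec) :
    pairing g x (v + v') w = pairing g x v w + pairing g x v' w := by
  simp only [pairing, Pi.add_apply, ← Finset.sum_add_distrib]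
  exact Finset.sum_congr rfl fun i _ => Finset.sum_congr rfl fun j _ => by ring

theorem pairing_smul_left (g : Vec → Matrix (Fin 4) (Fin 4) ℝ) (x v w : Vec) (c : ℝ) :
    pairing g x (c • v) w = c * pairing g x v w := by
  simp only [pairing, Pi.smul_apply, smul_eq_mul, Finset.mul_sum]
  exact Finset.sum_congr rfl fun i _ => Finset.sum_congr rfl fun j _ => by ring

theorem pairing_comm {g : Vec → Matrix (Fin 4) (Fin 4) ℝ} (x v w : Vec) (hg : (g x).IsSymm) :
    pairing g x v w = pairing g x w v := by
  simp only [pairing]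
  rw [Finset.sum_comm]
  refine Finset.sum_congr rfl fun i _ => Finset.sum_congr rfl fun j _ => ?_
  rw [hg.apply i j]; ring

theorem pairing_add_right {g : Vec → Matrix (Fin 4) (Fin 4) ℝ} (x v w w' : Vec)
    (hg : (g x).IsSymm) :
    pairing g x v (w + w') = pairing g x v w + pairing g x v w' := by
  rw [pairing_comm x v _ hg, pairing_add_left, pairing_comm x w _ hg, pairing_comm x w' _ hg]

theorem pairing_smul_right {g : Vec → Matrix (Fin 4) (Fin 4) ℝ} (x v w : Vec) (c : ℝ)
    (hg : (g x).IsSymm) :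
    pairing g x v (c • w) = c * pairing g x v w := by
  rw [pairing_comm x v _ hg, pairing_smul_left, pairing_comm x w _ hg]

/-- The connection is tensorial in `X` but differentiates `Y`, hence a pointwise hypothesis for one
and a germ for the other. The splittings of e₃ and e₄ hold only over `U`, so germs are all that is
available. -/
theorem covDeriv_congr (g : Vec → Matrix (Fin 4) (Fin 4) ℝ) {X X' Y Y' : Vec → Vec} {x : Vec}
    (hX : X x = X' x) (hY : Y =ᶠ[𝓝 x] Y') : covDeriv g X Y x = covDeriv g X' Y' x := by
  ext k
  have h : (fun y => Y y k) =ᶠ[𝓝 x] fun y => Y' y k := hY.mono fun y hy => by simp only [hy]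
  simp only [covDeriv, dirDeriv, hX, hY.eq_of_nhds, h.fderiv_eq]

theorem covDeriv_add_left (g : Vec → Matrix (Fin 4) (Fin 4) ℝ) (X X' Y : Vec → Vec) (x : Vec) :
    covDeriv g (X + X') Y x = covDeriv g X Y x + covDeriv g X' Y x := by
  ext k
  simp only [covDeriv, dirDeriv, Pi.add_apply, map_add]
  rw [add_add_add_comm, ← Finset.sum_add_distrib]
  congr 1
  refine Finset.sum_congr rfl fun i _ => ?_
  rw [← Finset.sum_add_distrib]
  exact Finset.sum_congr rfl fun j _ => by ring

theorem covDeriv_add_right (g : Vec → Matrix (Fin 4) (Fin 4) ℝ) (X : Vec → Vec)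
    {Y Y' : Vec → Vec} {x : Vec} (hY : DifferentiableAt ℝ Y x) (hY' : DifferentiableAt ℝ Y' x) :
    covDeriv g X (Y + Y') x = covDeriv g X Y x + covDeriv g X Y' x := by
  ext k
  have h : fderiv ℝ (fun y => Y y k + Y' y k) x
      = fderiv ℝ (fun y => Y y k) x + fderiv ℝ (fun y => Y' y k) x :=
    fderiv_fun_add (differentiableAt_pi.1 hY k) (differentiableAt_pi.1 hY' k)
  simp only [covDeriv, dirDeriv, Pi.add_apply, h, _root_.add_apply]
  rw [add_add_add_comm, ← Finset.sum_add_distrib]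
  congr 1
  refine Finset.sum_congr rfl fun i _ => ?_
  rw [← Finset.sum_add_distrib]
  exact Finset.sum_congr rfl fun j _ => by ring

theorem covDeriv_smul_right (g : Vec → Matrix (Fin 4) (Fin 4) ℝ) (X : Vec → Vec)
    {f : Vec → ℝ} {Y : Vec → Vec} {x : Vec} (hf : DifferentiableAt ℝ f x)
    (hY : DifferentiableAt ℝ Y x) :
    covDeriv g X (f • Y) x = dirDeriv (X x) f x • Y x + f x • covDeriv g X Y x := by
  ext k
  have h : fderiv ℝ (fun y => f y * Y y k) x
      = f x • fderiv ℝ (fun y => Y y k) x + Y x k • fderiv ℝ f x :=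
    fderiv_fun_mul hf (differentiableAt_pi.1 hY k)
  simp only [covDeriv, dirDeriv, Pi.add_apply, Pi.smul_apply', Pi.smul_apply, smul_eq_mul, h,
    _root_.add_apply, _root_.smul_apply, mul_add, Finset.mul_sum]
  rw [← add_assoc]
  congr 1
  · ring
  · exact Finset.sum_congr rfl fun i _ => Finset.sum_congr rfl fun j _ => by ring

/-! ### Metric compatibility -/

/-- The Christoffel symbols of the first kind, `Γ_{l,ij}`. -/
noncomputable def christoffelLower (g : Vec → Matrix (Fin 4) (Fin 4) ℝ) (x : Vec) (l i j : Fin 4) : ℝ :=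
  (1 / 2) * (partialDeriv i (fun y => g y j l) x + partialDeriv j (fun y => g y i l) x
      - partialDeriv l (fun y => g y i j) x)

/-- Lowering the index cancels the inverse metric, so that later computations involve only
derivatives of the coefficients. -/
theorem sum_mul_christoffel {g : Vec → Matrix (Fin 4) (Fin 4) ℝ} {x : Vec}
    (hg : (g x).IsSymm) (hdet : IsUnit (g x).det) (l i j : Fin 4) :
    ∑ k, g x k l * christoffel g x k i j = christoffelLower g x l i j := by
  set F : Fin 4 → ℝ := fun m => partialDeriv i (fun y => g y j m) x +
    partialDeriv j (fun y => g y i m) x - partialDeriv m (fun y => g y i j) x with hF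
  have h : ∀ m, ∑ k, g x l k * (g x)⁻¹ k m = (1 : Matrix (Fin 4) (Fin 4) ℝ) l m := fun m => by
    rw [← Matrix.mul_apply, Matrix.mul_nonsing_inv _ hdet]
  calc ∑ k, g x k l * christoffel g x k i j
      = ∑ k, ∑ m, (1 / 2) * (g x l k * (g x)⁻¹ k m * F m) := by
        refine Finset.sum_congr rfl fun k _ => ?_
        rw [christoffel, hg.apply l k, Finset.mul_sum, Finset.mul_sum]
        exact Finset.sum_congr rfl fun m _ => by ring
    _ = ∑ m, (1 / 2) * ((∑ k, g x l k * (g x)⁻¹ k m) * F m) := by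
        rw [Finset.sum_comm]
        exact Finset.sum_congr rfl fun m _ => by rw [← Finset.mul_sum, ← Finset.sum_mul]
    _ = christoffelLower g x l i j := by
        simp only [h, Matrix.one_apply, ite_mul, one_mul, zero_mul, mul_ite, mul_zero,
          Finset.sum_ite_eq, Finset.mem_univ, if_true, christoffelLower, hF]

theorem pairing_covDeriv {g : Vec → Matrix (Fin 4) (Fin 4) ℝ} {x : Vec}
    (hg : (g x).IsSymm) (hdet : IsUnit (g x).det) (X Y : Vec → Vec) (Z : Vec) :
    pairing g x (covDeriv g X Y x) Z =
      (∑ k, ∑ l, g x k l * dirDeriv (X x) (fun y => Y y k) x * Z l) +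
        ∑ i, ∑ j, ∑ l, christoffelLower g x l i j * X x i * Y x j * Z l := by
  simp only [pairing, covDeriv, mul_add, add_mul, Finset.sum_add_distrib]
  congr 1
  simp only [← sum_mul_christoffel hg hdet, Finset.mul_sum, Finset.sum_mul]
  calc _ = ∑ l, ∑ k, ∑ i, ∑ j, g x k l * (christoffel g x k i j * X x i * Y x j) * Z l :=
        Finset.sum_comm
    _ = ∑ l, ∑ i, ∑ k, ∑ j, g x k l * (christoffel g x k i j * X x i * Y x j) * Z l :=
        Finset.sum_congr rfl fun l _ => Finset.sum_comm
    _ = ∑ l, ∑ i, ∑ j, ∑ k, g x k l * (christoffel g x k i j * X x i * Y x j) * Z l :=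
        Finset.sum_congr rfl fun l _ => Finset.sum_congr rfl fun i _ => Finset.sum_comm
    _ = ∑ i, ∑ l, ∑ j, ∑ k, g x k l * (christoffel g x k i j * X x i * Y x j) * Z l :=
        Finset.sum_comm
    _ = ∑ i, ∑ j, ∑ l, ∑ k, g x k l * (christoffel g x k i j * X x i * Y x j) * Z l :=
        Finset.sum_congr rfl fun i _ => Finset.sum_comm
    _ = _ := Finset.sum_congr rfl fun i _ => Finset.sum_congr rfl fun j _ =>
        Finset.sum_congr rfl fun l _ => Finset.sum_congr rfl fun k _ => by ring

/-- The Levi-Civita connection is compatible with the metric. -/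
theorem dirDeriv_pairing {g : Vec → Matrix (Fin 4) (Fin 4) ℝ} {x : Vec}
    (hg : ∀ y, (g y).IsSymm) (hdet : IsUnit (g x).det)
    (hgd : ∀ i j, DifferentiableAt ℝ (fun y => g y i j) x) (X : Vec → Vec) {Y Z : Vec → Vec}
    (hY : DifferentiableAt ℝ Y x) (hZ : DifferentiableAt ℝ Z x) :
    dirDeriv (X x) (fun y => pairing g y (Y y) (Z y)) x =
      pairing g x (covDeriv g X Y x) (Z x) + pairing g x (covDeriv g X Z x) (Y x) := by
  have hYk := differentiableAt_pi.1 hY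
  have hZk := differentiableAt_pi.1 hZ
  have key : HasFDerivAt (fun y => pairing g y (Y y) (Z y))
      (∑ k, ∑ l, ((g x k l * Y x k) • fderiv ℝ (fun y => Z y l) x + Z x l •
        (g x k l • fderiv ℝ (fun y => Y y k) x + Y x k • fderiv ℝ (fun y => g y k l) x))) x := by
    refine HasFDerivAt.fun_sum fun k _ => HasFDerivAt.fun_sum fun l _ => ?_
    exact ((hgd k l).hasFDerivAt.mul (hYk k).hasFDerivAt).mul (hZk l).hasFDerivAt
  rw [pairing_covDeriv (hg x) hdet, pairing_covDeriv (hg x) hdet, dirDeriv, key.fderiv]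
  simp only [_root_.sum_apply, _root_.add_apply,
    _root_.smul_apply, smul_eq_mul, mul_add, Finset.sum_add_distrib]
  have h1 : ∑ k, ∑ l, g x k l * dirDeriv (X x) (fun y => Z y k) x * Y x l
      = ∑ k, ∑ l, g x k l * Y x k * fderiv ℝ (fun y => Z y l) x (X x) := by
    rw [Finset.sum_comm]
    refine Finset.sum_congr rfl fun k _ => Finset.sum_congr rfl fun l _ => ?_
    rw [(hg x).apply k l, dirDeriv]; ring
  have h2 : ∑ k, ∑ l, g x k l * dirDeriv (X x) (fun y => Y y k) x * Z x l
      = ∑ k, ∑ l, Z x l * (g x k l * fderiv ℝ (fun y => Y y k) x (X x)) :=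
    Finset.sum_congr rfl fun k _ => Finset.sum_congr rfl fun l _ => by rw [dirDeriv]; ring
  have h3 : ∑ i, ∑ j, ∑ l, christoffelLower g x l i j * X x i * Y x j * Z x l +
      ∑ i, ∑ j, ∑ l, christoffelLower g x l i j * X x i * Z x j * Y x l =
      ∑ k, ∑ l, Z x l * (Y x k * fderiv ℝ (fun y => g y k l) x (X x)) := by
    have hs : ∀ i j, (fun y => g y i j) = fun y => g y j i := fun i j =>
      funext fun y => (hg y).apply j i
    calc _ = ∑ i, ∑ j, ∑ l, (christoffelLower g x l i j * X x i * Y x j * Z x l +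
          christoffelLower g x j i l * X x i * Z x l * Y x j) := by
          simp only [Finset.sum_add_distrib]
          congr 1
          exact Finset.sum_congr rfl fun i _ => Finset.sum_comm
      _ = ∑ i, ∑ j, ∑ l, Z x l * (Y x j * (X x i * partialDeriv i (fun y => g y j l) x)) := by
          refine Finset.sum_congr rfl fun i _ => Finset.sum_congr rfl fun j _ =>
            Finset.sum_congr rfl fun l _ => ?_
          -- Γ_{l,ij} + Γ_{j,il} = ∂_i g_{jl}: the remaining derivatives cancel in pairs.
          rw [christoffelLower, christoffelLower, hs l j]; ring
      _ = _ := by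
          rw [Finset.sum_comm]
          refine Finset.sum_congr rfl fun j _ => ?_
          rw [Finset.sum_comm]
          refine Finset.sum_congr rfl fun l _ => ?_
          rw [fderiv_apply_eq_sum, Finset.mul_sum, Finset.mul_sum]
  rw [← h1, ← h2, ← h3]
  ring

/-- Applied to the constants g(T, T), g(n, n), g(T, n), this gives g(D_X T, T) = g(D_X n, n) = 0 and
g(D_X n, T) = -g(D_X T, n). -/
theorem pairing_covDeriv_add_eq_zero {g : Vec → Matrix (Fin 4) (Fin 4) ℝ} {x : Vec}
    (hg : ∀ y, (g y).IsSymm) (hdet : IsUnit (g x).det)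
    (hgd : ∀ i j, DifferentiableAt ℝ (fun y => g y i j) x) (X : Vec → Vec) {Y Z : Vec → Vec}
    (hY : DifferentiableAt ℝ Y x) (hZ : DifferentiableAt ℝ Z x) {c : ℝ}
    (hc : (fun y => pairing g y (Y y) (Z y)) =ᶠ[𝓝 x] fun _ => c) :
    pairing g x (covDeriv g X Y x) (Z x) + pairing g x (covDeriv g X Z x) (Y x) = 0 := by
  rw [← dirDeriv_pairing hg hdet hgd X hY hZ, dirDeriv, hc.fderiv_eq]
  simp

/-- An injective endomorphism in finite dimension is invertible, so `inverse` is the true inverse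
here and not its default value 0. -/
theorem coordVec_eq {y : Vec → Vec} {x : Vec} {y' : Vec →L[ℝ] Vec} (hy : HasFDerivAt y y' x)
    (hinj : ∀ v, y' v = 0 → v = 0) {i : Fin 4} {v : Vec} (hv : y' v = Pi.single i 1) :
    coordVec y i x = v := by
  have hi : Function.Injective y'.toLinearMap := (injective_iff_map_eq_zero _).2 hinj
  have hinv : y'.IsInvertible :=
    ⟨(LinearEquiv.ofInjectiveEndo y'.toLinearMap hi).toContinuousLinearEquiv, by ext; simp⟩
  rw [coordVec, hy.fderiv, hinv.inverse_apply_eq, hv]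

theorem pairing_neg_left (g : Vec → Matrix (Fin 4) (Fin 4) ℝ) (x v w : Vec) :
    pairing g x (-v) w = -pairing g x v w := by
  simp [pairing]

theorem pairing_neg_right (g : Vec → Matrix (Fin 4) (Fin 4) ℝ) (x v w : Vec) :
    pairing g x v (-w) = -pairing g x v w := by
  simp [pairing]

theorem covDeriv_neg_left (g : Vec → Matrix (Fin 4) (Fin 4) ℝ) (X Y : Vec → Vec) (x : Vec) :
    covDeriv g (-X) Y x = -covDeriv g X Y x := by
  ext k
  simp only [covDeriv, dirDeriv, Pi.neg_apply, map_neg, mul_neg, neg_mul, Finset.sum_neg_distrib]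
  ring

theorem covDeriv_neg_right (g : Vec → Matrix (Fin 4) (Fin 4) ℝ) (X Y : Vec → Vec) (x : Vec) :
    covDeriv g X (-Y) x = -covDeriv g X Y x := by
  ext k
  have h : fderiv ℝ (fun y => -Y y k) x = -fderiv ℝ (fun y => Y y k) x := fderiv_fun_neg
  simp only [covDeriv, dirDeriv, Pi.neg_apply, h, neg_apply, mul_neg, Finset.sum_neg_distrib]
  ring

/-! ### Connection coefficients of a null pair T ∓ n -/

/-- For a null pair `e₃ = T - n`, `e₄ = T + n` built from an orthonormal pair `T`, `n`, the torsion
is `-g(D_X T, n)`. -/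
theorem torsion_eq_neg_pairing {g : Vec → Matrix (Fin 4) (Fin 4) ℝ} {x : Vec}
    (hg : ∀ y, (g y).IsSymm) (hdet : IsUnit (g x).det)
    (hgd : ∀ i j, DifferentiableAt ℝ (fun y => g y i j) x) (X : Vec → Vec) {T n e₃ e₄ : Vec → Vec}
    (hT : DifferentiableAt ℝ T x) (hn : DifferentiableAt ℝ n x)
    (h3 : e₃ =ᶠ[𝓝 x] T + -n) (h4 : e₄ =ᶠ[𝓝 x] T + n)
    (hTT : (fun y => pairing g y (T y) (T y)) =ᶠ[𝓝 x] fun _ => -1)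
    (hnn : (fun y => pairing g y (n y) (n y)) =ᶠ[𝓝 x] fun _ => 1)
    (hTn : (fun y => pairing g y (T y) (n y)) =ᶠ[𝓝 x] fun _ => 0) :
    torsion g e₃ e₄ X x = -pairing g x (covDeriv g X T x) (n x) := by
  have a1 := pairing_covDeriv_add_eq_zero hg hdet hgd X hT hT hTT
  have a2 := pairing_covDeriv_add_eq_zero hg hdet hgd X hn hn hnn
  have a3 := pairing_covDeriv_add_eq_zero hg hdet hgd X hT hn hTn
  rw [torsion, covDeriv_congr g rfl h4, h3.eq_of_nhds, covDeriv_add_right g X hT hn]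
  simp only [Pi.add_apply, Pi.neg_apply, pairing_add_left, pairing_add_right _ _ _ _ (hg x),
    pairing_neg_right]
  linarith

/-- By orthonormality ω = -½ g(D_{T+n} T, n) and ω̲ = ½ g(D_{T-n} T, n); in the sum the derivatives
along T cancel. -/
theorem nullLapse_add_nullLapse {g : Vec → Matrix (Fin 4) (Fin 4) ℝ} {x : Vec}
    (hg : ∀ y, (g y).IsSymm) (hdet : IsUnit (g x).det)
    (hgd : ∀ i j, DifferentiableAt ℝ (fun y => g y i j) x) {T n e₃ e₄ : Vec → Vec}
    (hT : DifferentiableAt ℝ T x) (hn : DifferentiableAt ℝ n x)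
    (h3 : e₃ =ᶠ[𝓝 x] T + -n) (h4 : e₄ =ᶠ[𝓝 x] T + n)
    (hTT : (fun y => pairing g y (T y) (T y)) =ᶠ[𝓝 x] fun _ => -1)
    (hnn : (fun y => pairing g y (n y) (n y)) =ᶠ[𝓝 x] fun _ => 1)
    (hTn : (fun y => pairing g y (T y) (n y)) =ᶠ[𝓝 x] fun _ => 0) :
    nullLapse g e₃ e₄ x + nullLapse g e₄ e₃ x = -pairing g x (covDeriv g n T x) (n x) := by
  have hTT' := fun X => pairing_covDeriv_add_eq_zero hg hdet hgd X hT hT hTT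
  have hnn' := fun X => pairing_covDeriv_add_eq_zero hg hdet hgd X hn hn hnn
  have hTn' := fun X => pairing_covDeriv_add_eq_zero hg hdet hgd X hT hn hTn
  rw [nullLapse, nullLapse, covDeriv_congr g h4.eq_of_nhds h3, covDeriv_congr g h3.eq_of_nhds h4,
    h3.eq_of_nhds, h4.eq_of_nhds, covDeriv_add_right g _ hT hn, covDeriv_add_right g _ hT hn.neg]
  simp only [Pi.add_apply, Pi.neg_apply, pairing_add_left, pairing_add_right _ _ _ _ (hg x),
    pairing_neg_right, pairing_neg_left, covDeriv_add_left, covDeriv_neg_left, covDeriv_neg_right]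
  linarith [hTT' T, hTT' n, hnn' T, hnn' n, hTn' T, hTn' n]

theorem nullForm_add_nullForm {g : Vec → Matrix (Fin 4) (Fin 4) ℝ} {x : Vec}
    (X Y : Vec → Vec) {T n e₃ e₄ : Vec → Vec}
    (hT : DifferentiableAt ℝ T x) (hn : DifferentiableAt ℝ n x)
    (h3 : e₃ =ᶠ[𝓝 x] T + -n) (h4 : e₄ =ᶠ[𝓝 x] T + n) :
    nullForm g e₄ X Y x + nullForm g e₃ X Y x = 2 * pairing g x (covDeriv g X T x) (Y x) := by
  rw [nullForm, nullForm, covDeriv_congr g rfl h3, covDeriv_congr g rfl h4,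
    covDeriv_add_right g _ hT hn, covDeriv_add_right g _ hT hn.neg, covDeriv_neg_right]
  simp only [pairing_add_left, pairing_neg_left]
  ring

/-- The Koszul formula for a field `Y` whose frozen value at `x` annihilates the metric
coefficients. -/
theorem pairing_covDeriv_of_stationary {g : Vec → Matrix (Fin 4) (Fin 4) ℝ} {x : Vec}
    (hg : (g x).IsSymm) (hdet : IsUnit (g x).det) (X Y : Vec → Vec) (Z : Vec)
    (hY : ∀ i j, dirDeriv (Y x) (fun y => g y i j) x = 0) :
    pairing g x (covDeriv g X Y x) Z =
      (∑ k, ∑ l, g x k l * dirDeriv (X x) (fun y => Y y k) x * Z l) +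
        (1 / 2) * ((∑ j, ∑ l, dirDeriv (X x) (fun y => g y j l) x * Y x j * Z l) -
          ∑ i, ∑ j, dirDeriv Z (fun y => g y i j) x * X x i * Y x j) := by
  rw [pairing_covDeriv hg hdet]
  congr 1
  -- The Koszul term that differentiates the metric along `Y` is zero; it is restored below only to
  -- assemble the symbols Γ_{l,ij}.
  have h0 : ∑ i, ∑ l, dirDeriv (Y x) (fun y => g y i l) x * X x i * Z l = 0 := by simp [hY]
  have hs : ∑ j, ∑ l, dirDeriv (X x) (fun y => g y j l) x * Y x j * Z l
      + ∑ i, ∑ l, dirDeriv (Y x) (fun y => g y i l) x * X x i * Z l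
      - ∑ i, ∑ j, dirDeriv Z (fun y => g y i j) x * X x i * Y x j
      = 2 * ∑ i, ∑ j, ∑ l, christoffelLower g x l i j * X x i * Y x j * Z l := by
    simp only [dirDeriv, fderiv_apply_eq_sum, Fin.sum_univ_four, christoffelLower]
    ring
  rw [h0, add_zero] at hs
  rw [hs]; ring

/-! ### Algebra of the Kerr metric in the exterior -/

/-- `A = (r² + a²)² - Δ a² sin² θ`, so that `Σ R² = A`. -/
noncomputable def areaCoeff (M a : ℝ) (x : Vec) : ℝ :=
  (x 1 ^ 2 + a ^ 2) ^ 2 - Delta M a x * a ^ 2 * Real.sin (x 2) ^ 2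

section Exterior

variable {M a : ℝ} {x : Vec}

theorem radius_pos (hM : 0 < M) (hx : (x 1, x 2) ∈ exterior M a) : 0 < x 1 :=
  lt_of_le_of_lt (add_nonneg hM.le (Real.sqrt_nonneg _)) hx.1

theorem Sigma_pos (hM : 0 < M) (hx : (x 1, x 2) ∈ exterior M a) : 0 < Sigma a x := by
  have := radius_pos hM hx
  unfold Sigma; positivity

/-- Δ = (r - M)² - (M² - a²), and r - M exceeds the root of the last bracket. -/
theorem Delta_pos (ha : |a| ≤ M) (hx : (x 1, x 2) ∈ exterior M a) :
    0 < Delta M a x := by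
  have h1 : 0 ≤ M ^ 2 - a ^ 2 := sub_nonneg.2 (sq_le_sq.2 (ha.trans (le_abs_self M)))
  have h2 : √(M ^ 2 - a ^ 2) < x 1 - M := by linarith [show M + √(M ^ 2 - a ^ 2) < x 1 from hx.1]
  have h3 := (Real.sqrt_lt h1 ((Real.sqrt_nonneg _).trans h2.le)).1 h2
  unfold Delta; nlinarith

theorem sin_theta_pos (hx : (x 1, x 2) ∈ exterior M a) : 0 < Real.sin (x 2) :=
  Real.sin_pos_of_pos_of_lt_pi hx.2.1 hx.2.2

/-- Since Δ ≤ r² + a², A is at least (r² + a²) r². -/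
theorem areaCoeff_pos (hM : 0 < M) (ha : |a| ≤ M) (hx : (x 1, x 2) ∈ exterior M a) :
    0 < areaCoeff M a x := by
  have hr := radius_pos hM hx
  have hD := Delta_pos ha hx
  have hs : Real.sin (x 2) ^ 2 ≤ 1 := Real.sin_sq_le_one _
  have h1 : Delta M a x * a ^ 2 * Real.sin (x 2) ^ 2 ≤ Delta M a x * a ^ 2 :=
    mul_le_of_le_one_right (by positivity) hs
  have h2 : Delta M a x * a ^ 2 ≤ (x 1 ^ 2 + a ^ 2) * a ^ 2 := by
    refine mul_le_mul_of_nonneg_right ?_ (sq_nonneg a)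
    unfold Delta; nlinarith [mul_pos hM hr]
  have h3 : 0 < (x 1 ^ 2 + a ^ 2) * x 1 ^ 2 := by positivity
  unfold areaCoeff; nlinarith

theorem bigR_sq (hM : 0 < M) (ha : |a| ≤ M) (hx : (x 1, x 2) ∈ exterior M a) :
    bigR M a x ^ 2 = areaCoeff M a x / Sigma a x :=
  Real.sq_sqrt (div_pos (areaCoeff_pos hM ha hx) (Sigma_pos hM hx)).le

theorem bigR_pos (hM : 0 < M) (ha : |a| ≤ M) (hx : (x 1, x 2) ∈ exterior M a) :
    0 < bigR M a x :=
  Real.sqrt_pos.2 (div_pos (areaCoeff_pos hM ha hx) (Sigma_pos hM hx))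

theorem omegaB_eq (hM : 0 < M) (ha : |a| ≤ M) (hx : (x 1, x 2) ∈ exterior M a) :
    omegaB M a x = 2 * M * a * x 1 / areaCoeff M a x := by
  rw [omegaB, bigR_sq hM ha hx, mul_div_cancel₀ _ (Sigma_pos hM hx).ne']

theorem Omega_sq (hM : 0 < M) (ha : |a| ≤ M) (hx : (x 1, x 2) ∈ exterior M a) :
    Omega M a x ^ 2 = Delta M a x * Sigma a x / areaCoeff M a x := by
  have hR := bigR_pos hM ha hx
  have hD := Delta_pos ha hx
  rw [Omega, Real.sq_sqrt (by positivity), bigR_sq hM ha hx, div_div_eq_mul_div]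

theorem Omega_pos (hM : 0 < M) (ha : |a| ≤ M) (hx : (x 1, x 2) ∈ exterior M a) :
    0 < Omega M a x :=
  Real.sqrt_pos.2 (div_pos (Delta_pos ha hx) (pow_pos (bigR_pos hM ha hx) 2))

theorem Sigma_eq (a : ℝ) (x : Vec) : Sigma a x = x 1 ^ 2 + a ^ 2 - a ^ 2 * Real.sin (x 2) ^ 2 := by
  rw [Sigma, Real.cos_sq']; ring

/-- `(Δ - a² sin² θ) A + 4 M² a² r² sin² θ = Δ Σ²`. -/
theorem areaCoeff_identity (M a : ℝ) (x : Vec) :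
    (Delta M a x - a ^ 2 * Real.sin (x 2) ^ 2) * areaCoeff M a x +
      4 * M ^ 2 * a ^ 2 * x 1 ^ 2 * Real.sin (x 2) ^ 2 = Delta M a x * Sigma a x ^ 2 := by
  rw [Sigma_eq, areaCoeff, Delta]; ring

theorem metric_isSymm (M a : ℝ) (x : Vec) : (metric M a x).IsSymm := by
  ext i j
  fin_cases i <;> fin_cases j <;> simp [metric]

/-- The matrix `g^{μν}`. -/
noncomputable def inverseMetric (M a : ℝ) (x : Vec) : Matrix (Fin 4) (Fin 4) ℝ :=
  let S := Sigma a x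
  let D := Delta M a x
  let s := Real.sin (x 2) ^ 2
  !![-(areaCoeff M a x / (S * D)), 0, 0, -(2 * M * a * x 1 / (S * D));
     0, D / S, 0, 0;
     0, 0, 1 / S, 0;
     -(2 * M * a * x 1 / (S * D)), 0, 0, (D - a ^ 2 * s) / (S * D * s)]

theorem metric_mul_inverseMetric (hM : 0 < M) (ha : |a| ≤ M) (hx : (x 1, x 2) ∈ exterior M a) :
    metric M a x * inverseMetric M a x = 1 := by
  have hS := (Sigma_pos hM hx).ne'
  have hD := (Delta_pos ha hx).ne'
  have hs := (sin_theta_pos hx).ne'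
  have hid := areaCoeff_identity M a x
  have hA : (x 1 ^ 2 + a ^ 2) ^ 2 - Delta M a x * a ^ 2 * Real.sin (x 2) ^ 2 = areaCoeff M a x :=
    rfl
  have hrD : x 1 ^ 2 + a ^ 2 - Delta M a x = 2 * M * x 1 := by rw [Delta]; ring
  simp only [metric, inverseMetric, hA, hrD]
  generalize areaCoeff M a x = A at *
  generalize Sigma a x = S at *
  generalize Delta M a x = D at *
  ext i j
  fin_cases i <;> fin_cases j <;>
    simp [Matrix.mul_apply, Fin.sum_univ_four] <;> field_simp <;>
      -- The identity for A is needed in the two diagonal entries of the t–φ block.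
      first | ring1 | linear_combination hid

theorem isUnit_det_metric (hM : 0 < M) (ha : |a| ≤ M) (hx : (x 1, x 2) ∈ exterior M a) :
    IsUnit (metric M a x).det :=
  Matrix.isUnit_det_of_right_inverse (metric_mul_inverseMetric hM ha hx)

theorem metric_inv (hM : 0 < M) (ha : |a| ≤ M) (hx : (x 1, x 2) ∈ exterior M a) :
    (metric M a x)⁻¹ = inverseMetric M a x :=
  Matrix.inv_eq_right_inv (metric_mul_inverseMetric hM ha hx)

/-- ω_B is the shift: this makes ∂_t + ω_B ∂_φ orthogonal to ∂_φ. Together with `metric_zero_zero`,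
where Ω appears as the lapse, it puts the t–φ block in the form -Ω² dt² + g_φφ (dφ - ω_B dt)². -/
theorem metric_zero_three (hM : 0 < M) (ha : |a| ≤ M) (hx : (x 1, x 2) ∈ exterior M a) :
    metric M a x 0 3 = -(omegaB M a x * metric M a x 3 3) := by
  have hA : (x 1 ^ 2 + a ^ 2) ^ 2 - Delta M a x * a ^ 2 * Real.sin (x 2) ^ 2 = areaCoeff M a x :=
    rfl
  have hrD : x 1 ^ 2 + a ^ 2 - Delta M a x = 2 * M * x 1 := by rw [Delta]; ring
  have hS := (Sigma_pos hM hx).ne'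
  have hA0 := (areaCoeff_pos hM ha hx).ne'
  rw [omegaB_eq hM ha hx]
  simp only [metric, hA, hrD]
  simp
  field_simp

theorem metric_three_three (hM : 0 < M) (ha : |a| ≤ M) (hx : (x 1, x 2) ∈ exterior M a) :
    metric M a x 3 3 = (bigR M a x * Real.sin (x 2)) ^ 2 := by
  rw [mul_pow, bigR_sq hM ha hx]; simp [metric, areaCoeff]

theorem metric_zero_zero (hM : 0 < M) (ha : |a| ≤ M) (hx : (x 1, x 2) ∈ exterior M a) :
    metric M a x 0 0 = omegaB M a x ^ 2 * metric M a x 3 3 - Omega M a x ^ 2 := by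
  have hA : (x 1 ^ 2 + a ^ 2) ^ 2 - Delta M a x * a ^ 2 * Real.sin (x 2) ^ 2 = areaCoeff M a x :=
    rfl
  have hS := (Sigma_pos hM hx).ne'
  have hA0 := (areaCoeff_pos hM ha hx).ne'
  have hid := areaCoeff_identity M a x
  rw [omegaB_eq hM ha hx, Omega_sq hM ha hx]
  simp only [metric, hA]
  simp
  field_simp
  linear_combination -hid

end Exterior

/-! ### Regularity and symmetries of the metric coefficients -/

theorem metric_congr (M a : ℝ) {x y : Vec} (h1 : x 1 = y 1) (h2 : x 2 = y 2) :
    metric M a x = metric M a y := by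
  simp only [metric, Sigma, Delta, h1, h2]

theorem differentiable_Sigma (a : ℝ) : Differentiable ℝ (Sigma a) := by
  unfold Sigma; fun_prop

theorem differentiable_Delta (M a : ℝ) : Differentiable ℝ (Delta M a) := by
  unfold Delta; fun_prop

theorem differentiable_areaCoeff (M a : ℝ) : Differentiable ℝ (areaCoeff M a) := by
  have := differentiable_Delta M a
  unfold areaCoeff; fun_prop

section Exterior

variable {M a : ℝ} {x : Vec}

theorem isOpen_exterior (M a : ℝ) : IsOpen (exterior M a) :=
  (isOpen_lt continuous_const continuous_fst).inter (isOpen_Ioo.preimage continuous_snd)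

theorem eventually_mem_of_isOpen {U : Set (ℝ × ℝ)} (hU : IsOpen U) (hx : (x 1, x 2) ∈ U) :
    ∀ᶠ y : Vec in 𝓝 x, (y 1, y 2) ∈ U :=
  (hU.preimage (by fun_prop : Continuous fun y : Vec => (y 1, y 2))).mem_nhds hx

theorem differentiableAt_bigR (hM : 0 < M) (ha : |a| ≤ M) (hx : (x 1, x 2) ∈ exterior M a) :
    DifferentiableAt ℝ (bigR M a) x := by
  have hS := (Sigma_pos hM hx).ne'
  have dS := differentiable_Sigma a
  have dA := differentiable_areaCoeff M a
  have h : DifferentiableAt ℝ (fun y => areaCoeff M a y / Sigma a y) x := by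
    fun_prop (disch := assumption)
  exact h.sqrt (div_ne_zero (areaCoeff_pos hM ha hx).ne' hS)

theorem differentiableAt_omegaB (hM : 0 < M) (ha : |a| ≤ M) (hx : (x 1, x 2) ∈ exterior M a) :
    DifferentiableAt ℝ (omegaB M a) x := by
  have hS := Sigma_pos hM hx
  have hR := bigR_pos hM ha hx
  have dS := differentiable_Sigma a
  have dR := differentiableAt_bigR hM ha hx
  have h0 : Sigma a x * bigR M a x ^ 2 ≠ 0 := by positivity
  unfold omegaB
  fun_prop (disch := assumption)

theorem differentiableAt_Omega (hM : 0 < M) (ha : |a| ≤ M) (hx : (x 1, x 2) ∈ exterior M a) :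
    DifferentiableAt ℝ (Omega M a) x := by
  have hD := Delta_pos ha hx
  have hR := bigR_pos hM ha hx
  have dD := differentiable_Delta M a
  have dR := differentiableAt_bigR hM ha hx
  have h0 : bigR M a x ^ 2 ≠ 0 := by positivity
  have h : DifferentiableAt ℝ (fun y => Delta M a y / bigR M a y ^ 2) x := by
    fun_prop (disch := assumption)
  exact h.sqrt (by positivity)

theorem differentiableAt_metric (hM : 0 < M) (ha : |a| ≤ M) (hx : (x 1, x 2) ∈ exterior M a)
    (i j : Fin 4) : DifferentiableAt ℝ (fun y => metric M a y i j) x := by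
  have hS := (Sigma_pos hM hx).ne'
  have hD := (Delta_pos ha hx).ne'
  have dS := differentiable_Sigma a x
  have dD := differentiable_Delta M a x
  fin_cases i <;> fin_cases j <;> simp [metric] <;> fun_prop (disch := assumption)

/-- A function of `(r, θ)` alone is annihilated by `∂_t` and `∂_φ`. -/
theorem dirDeriv_eq_zero_of_forall {f : Vec → ℝ} {v : Vec}
    (hf : ∀ x y : Vec, x 1 = y 1 → x 2 = y 2 → f x = f y) (h1 : v 1 = 0) (h2 : v 2 = 0) :
    dirDeriv v f x = 0 := by
  by_cases hd : DifferentiableAt ℝ f x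
  · rw [dirDeriv, ← hd.lineDeriv_eq_fderiv, lineDeriv]
    have : (fun t : ℝ => f (x + t • v)) = fun _ => f x :=
      funext fun t => hf _ _ (by simp [h1]) (by simp [h2])
    rw [this, deriv_const]
  -- Without differentiability `fderiv` takes its default value 0, so no regularity is assumed.
  · rw [dirDeriv, fderiv_zero_of_not_differentiableAt hd]; rfl

theorem omegaB_congr (M a : ℝ) (x y : Vec) (h1 : x 1 = y 1) (h2 : x 2 = y 2) :
    omegaB M a x = omegaB M a y := by
  simp only [omegaB, bigR, Sigma, Delta, h1, h2]

/-! ### Second fundamental form of the slices t = const -/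

/-- The field `∂_t + ω_B ∂_φ`, orthogonal to the slices `t = const`. -/
noncomputable def staticField (M a : ℝ) (x : Vec) : Vec := ![1, 0, 0, omegaB M a x]

theorem pairing_staticField (hM : 0 < M) (ha : |a| ≤ M) (hx : (x 1, x 2) ∈ exterior M a)
    {Z : Vec} (hZ : Z 0 = 0) : pairing (metric M a) x (staticField M a x) Z = 0 := by
  have h := metric_zero_three hM ha hx
  simp only [pairing, Fin.sum_univ_four, staticField, hZ]
  have h1 : metric M a x 0 1 = 0 := by simp [metric]
  have h2 : metric M a x 0 2 = 0 := by simp [metric]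
  have h3 : metric M a x 3 1 = 0 := by simp [metric]
  have h4 : metric M a x 3 2 = 0 := by simp [metric]
  simp [h, h1, h2, h3, h4]
  ring

theorem pairing_staticField_self (hM : 0 < M) (ha : |a| ≤ M) (hx : (x 1, x 2) ∈ exterior M a) :
    pairing (metric M a) x (staticField M a x) (staticField M a x) = -Omega M a x ^ 2 := by
  have h := metric_zero_three hM ha hx
  have h0 := metric_zero_zero hM ha hx
  have h' : metric M a x 3 0 = metric M a x 0 3 := (metric_isSymm M a x).apply 0 3
  simp only [pairing, Fin.sum_univ_four, staticField]
  simp [h, h0, h']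
  ring

theorem differentiableAt_staticField (hM : 0 < M) (ha : |a| ≤ M)
    (hx : (x 1, x 2) ∈ exterior M a) : DifferentiableAt ℝ (staticField M a) x := by
  refine differentiableAt_pi.2 fun k => ?_
  have := differentiableAt_omegaB hM ha hx
  fin_cases k <;> (simp [staticField]; try fun_prop)

/-- The second fundamental form of the slices `t = const`. -/
theorem pairing_covDeriv_staticField (hM : 0 < M) (ha : |a| ≤ M)
    (hx : (x 1, x 2) ∈ exterior M a) {X : Vec → Vec} {Z : Vec} (hX : X x 0 = 0) (hZ : Z 0 = 0) :
    pairing (metric M a) x (covDeriv (metric M a) X (staticField M a) x) Z =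
      (1 / 2) * metric M a x 3 3 *
        (dirDeriv (X x) (omegaB M a) x * Z 3 + dirDeriv Z (omegaB M a) x * X x 3) := by
  rw [pairing_covDeriv_of_stationary (metric_isSymm M a x) (isUnit_det_metric hM ha hx)]
  swap
  · exact fun i j => dirDeriv_eq_zero_of_forall
      (fun x y h1 h2 => by rw [metric_congr M a h1 h2]) rfl rfl
  have hd3 := differentiableAt_metric hM ha hx 3 3
  have hdω := differentiableAt_omegaB hM ha hx
  -- Differentiating g_tφ = -ω_B g_φφ produces a derivative of g_φφ that cancels the other one in
  -- the Koszul formula; only derivatives of ω_B remain.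
  have h03 : ∀ v, dirDeriv v (fun y => metric M a y 0 3) x =
      -(omegaB M a x * dirDeriv v (fun y => metric M a y 3 3) x +
        metric M a x 3 3 * dirDeriv v (omegaB M a) x) := fun v => by
    have he : (fun y => metric M a y 0 3) =ᶠ[𝓝 x] fun y => -(omegaB M a y * metric M a y 3 3) :=
      (eventually_mem_of_isOpen (isOpen_exterior M a) hx).mono fun y hy =>
        metric_zero_three hM ha hy
    rw [dirDeriv, he.fderiv_eq, fderiv_fun_neg, fderiv_fun_mul hdω hd3]
    rfl
  have h30 : ∀ v, dirDeriv v (fun y => metric M a y 3 0) x =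
      dirDeriv v (fun y => metric M a y 0 3) x := fun v => by
    rw [show (fun y => metric M a y 3 0) = fun y => metric M a y 0 3 from
      funext fun y => (metric_isSymm M a y).apply 0 3]
  have hc : ∀ (v : Vec) (c : ℝ), dirDeriv v (fun _ => c) x = 0 := fun v c => by simp [dirDeriv]
  have z : ∀ v i j, (∀ y, metric M a y i j = 0) → dirDeriv v (fun y => metric M a y i j) x = 0 :=
    fun v i j h => by simp only [h, hc]
  have z01 : ∀ y, metric M a y 0 1 = 0 := fun y => by simp [metric]
  have z02 : ∀ y, metric M a y 0 2 = 0 := fun y => by simp [metric]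
  have z31 : ∀ y, metric M a y 3 1 = 0 := fun y => by simp [metric]
  have z32 : ∀ y, metric M a y 3 2 = 0 := fun y => by simp [metric]
  have z10 : ∀ y, metric M a y 1 0 = 0 := fun y => by simp [metric]
  have z20 : ∀ y, metric M a y 2 0 = 0 := fun y => by simp [metric]
  have z13 : ∀ y, metric M a y 1 3 = 0 := fun y => by simp [metric]
  have z23 : ∀ y, metric M a y 2 3 = 0 := fun y => by simp [metric]
  have s0 : ∀ y, staticField M a y 0 = 1 := fun y => rfl
  have s1 : ∀ y, staticField M a y 1 = 0 := fun y => rfl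
  have s2 : ∀ y, staticField M a y 2 = 0 := fun y => rfl
  have s3 : ∀ y, staticField M a y 3 = omegaB M a y := fun y => rfl
  have hη : dirDeriv (X x) (fun y => omegaB M a y) x = dirDeriv (X x) (omegaB M a) x := rfl
  simp only [Fin.sum_univ_four, s0, s1, s2, s3, hc, hX, hZ, hη, z _ _ _ z01, z _ _ _ z02,
    z _ _ _ z10, z _ _ _ z20, z _ _ _ z13, z _ _ _ z23, z31, z32, h30, h03]
  ring

end Exterior

/-! ### Differentials of the coordinate systems -/

theorem fderiv_coordinate (i : Fin 4) (x v : Vec) :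
    fderiv ℝ (fun y : Vec => y i) x v = v i := by
  rw [(hasFDerivAt_apply (𝕜 := ℝ) i x).fderiv]; rfl

theorem fderiv_prod_apply (f : ℝ × ℝ → ℝ) (p : ℝ × ℝ) (c d : ℝ) :
    fderiv ℝ f p (c, d) = c * fderiv ℝ f p (1, 0) + d * fderiv ℝ f p (0, 1) := by
  have h : ((c, d) : ℝ × ℝ) = c • (1, 0) + d • (0, 1) := by simp
  rw [h, map_add, map_smul, map_smul, smul_eq_mul, smul_eq_mul]

theorem hasFDerivAt_comp_radius_angle {f : ℝ × ℝ → ℝ} {x : Vec}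
    (hf : DifferentiableAt ℝ f (x 1, x 2)) :
    HasFDerivAt (fun y : Vec => f (y 1, y 2))
      ((fderiv ℝ f (x 1, x 2)).comp ((ContinuousLinearMap.proj 1).prod
        (ContinuousLinearMap.proj 2))) x := by
  have h1 : HasFDerivAt (fun y : Vec => (y 1, y 2))
      ((ContinuousLinearMap.proj (R := ℝ) (φ := fun _ : Fin 4 => ℝ) 1).prod
        (ContinuousLinearMap.proj 2)) x :=
    (hasFDerivAt_apply 1 x).prodMk (hasFDerivAt_apply 2 x)
  exact HasFDerivAt.comp x (f := fun y : Vec => (y 1, y 2)) hf.hasFDerivAt h1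

theorem fderiv_comp_radius_angle {f : ℝ × ℝ → ℝ} {x : Vec}
    (hf : DifferentiableAt ℝ f (x 1, x 2)) (v : Vec) :
    fderiv ℝ (fun y : Vec => f (y 1, y 2)) x v =
      v 1 * fderiv ℝ f (x 1, x 2) (1, 0) + v 2 * fderiv ℝ f (x 1, x 2) (0, 1) := by
  rw [(hasFDerivAt_comp_radius_angle hf).fderiv, ← fderiv_prod_apply]
  rfl

theorem differentiableAt_ipCoord {rs ths : ℝ × ℝ → ℝ} {x : Vec}
    (hrs : DifferentiableAt ℝ rs (x 1, x 2)) (hths : DifferentiableAt ℝ ths (x 1, x 2)) :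
    DifferentiableAt ℝ (ipCoord rs ths) x := by
  have h1 := (hasFDerivAt_comp_radius_angle hrs).differentiableAt
  have h2 := (hasFDerivAt_comp_radius_angle hths).differentiableAt
  refine differentiableAt_pi.2 fun k => ?_
  fin_cases k <;> (simp [ipCoord, uFun, ubFun]; fun_prop)

theorem fderiv_uFun {rs : ℝ × ℝ → ℝ} {x : Vec}
    (hrs : DifferentiableAt ℝ rs (x 1, x 2)) (v : Vec) :
    fderiv ℝ (uFun rs) x v = (v 0 - (v 1 * fderiv ℝ rs (x 1, x 2) (1, 0) +
      v 2 * fderiv ℝ rs (x 1, x 2) (0, 1))) / 2 := by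
  have h : HasFDerivAt (uFun rs) _ x :=
    ((hasFDerivAt_apply 0 x).sub (hasFDerivAt_comp_radius_angle hrs)).mul_const 2⁻¹
  rw [h.fderiv, ← fderiv_prod_apply]
  simp [div_eq_inv_mul]

theorem fderiv_ubFun {rs : ℝ × ℝ → ℝ} {x : Vec}
    (hrs : DifferentiableAt ℝ rs (x 1, x 2)) (v : Vec) :
    fderiv ℝ (ubFun rs) x v = (v 0 + (v 1 * fderiv ℝ rs (x 1, x 2) (1, 0) +
      v 2 * fderiv ℝ rs (x 1, x 2) (0, 1))) / 2 := by
  have h : HasFDerivAt (ubFun rs) _ x :=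
    ((hasFDerivAt_apply 0 x).add (hasFDerivAt_comp_radius_angle hrs)).mul_const 2⁻¹
  rw [h.fderiv, ← fderiv_prod_apply]
  simp [div_eq_inv_mul, mul_add]

theorem fderiv_ipCoord {rs ths : ℝ × ℝ → ℝ} {x : Vec}
    (hrs : DifferentiableAt ℝ rs (x 1, x 2)) (hths : DifferentiableAt ℝ ths (x 1, x 2)) (v : Vec) :
    fderiv ℝ (ipCoord rs ths) x v =
      ![(v 0 - (v 1 * fderiv ℝ rs (x 1, x 2) (1, 0) + v 2 * fderiv ℝ rs (x 1, x 2) (0, 1))) / 2,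
        (v 0 + (v 1 * fderiv ℝ rs (x 1, x 2) (1, 0) + v 2 * fderiv ℝ rs (x 1, x 2) (0, 1))) / 2,
        v 1 * fderiv ℝ ths (x 1, x 2) (1, 0) + v 2 * fderiv ℝ ths (x 1, x 2) (0, 1),
        v 3] := by
  have h := differentiableAt_ipCoord hrs hths
  ext k
  refine (congrArg (· v) (fderiv_apply h k)).symm.trans ?_
  fin_cases k
  · exact fderiv_uFun hrs v
  · exact fderiv_ubFun hrs v
  · exact fderiv_comp_radius_angle hths v
  · exact fderiv_coordinate 3 x v

theorem fderiv_radialCoord {ths : ℝ × ℝ → ℝ} {x : Vec}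
    (hths : DifferentiableAt ℝ ths (x 1, x 2)) :
    DifferentiableAt ℝ (radialCoord ths) x ∧ ∀ v, fderiv ℝ (radialCoord ths) x v =
      ![v 0, v 1,
        v 1 * fderiv ℝ ths (x 1, x 2) (1, 0) + v 2 * fderiv ℝ ths (x 1, x 2) (0, 1),
        v 3] := by
  have h2 := (hasFDerivAt_comp_radius_angle hths).differentiableAt
  have h : DifferentiableAt ℝ (radialCoord ths) x := by
    refine differentiableAt_pi.2 fun k => ?_
    fin_cases k <;> (simp [radialCoord]; fun_prop)
  refine ⟨h, fun v => ?_⟩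
  ext k
  refine (congrArg (· v) (fderiv_apply h k)).symm.trans ?_
  fin_cases k
  · exact fderiv_coordinate 0 x v
  · exact fderiv_coordinate 1 x v
  · exact fderiv_comp_radius_angle hths v
  · exact fderiv_coordinate 3 x v

/-! ### Israel–Pretorius coordinate vectors -/

/-- The gradient of `r_*`. -/
noncomputable def gradRs (M a : ℝ) (rs : ℝ × ℝ → ℝ) (x : Vec) : Vec :=
  ![0, Delta M a x / Sigma a x * fderiv ℝ rs (x 1, x 2) (1, 0),
    fderiv ℝ rs (x 1, x 2) (0, 1) / Sigma a x, 0]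

section IsraelPretorius

variable {M a : ℝ} {U : Set (ℝ × ℝ)} {rs ths : ℝ × ℝ → ℝ} {x : Vec}

namespace IsIsraelPretorius

variable (hIP : IsIsraelPretorius M a U rs ths) (hM : 0 < M) (ha : |a| ≤ M)
  (hx : (x 1, x 2) ∈ U)

include hIP hx

theorem differentiableAt_rs : DifferentiableAt ℝ rs (x 1, x 2) :=
  (hIP.contDiffOn_rs.contDiffAt (hIP.isOpen.mem_nhds hx)).differentiableAt (by norm_num)

theorem differentiableAt_ths : DifferentiableAt ℝ ths (x 1, x 2) :=
  (hIP.contDiffOn_ths.contDiffAt (hIP.isOpen.mem_nhds hx)).differentiableAt (by norm_num)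

theorem differentiableAt_fderiv_rs (v : ℝ × ℝ) :
    DifferentiableAt ℝ (fun y : Vec => fderiv ℝ rs (y 1, y 2) v) x := by
  have h : ContDiffAt ℝ 1 (fderiv ℝ rs) (x 1, x 2) :=
    (hIP.contDiffOn_rs.contDiffAt (hIP.isOpen.mem_nhds hx)).fderiv_right (by norm_num)
  have h' : DifferentiableAt ℝ (fun p => fderiv ℝ rs p v) (x 1, x 2) :=
    (h.differentiableAt (by norm_num)).clm_apply (differentiableAt_const v)
  exact (hasFDerivAt_comp_radius_angle h').differentiableAt

include hM ha

/-- `Δ² (∂_r r_*)² + Δ (∂_θ r_*)² = A`. -/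
theorem eikonal_eq :
    Delta M a x * (Delta M a x * fderiv ℝ rs (x 1, x 2) (1, 0) ^ 2 +
      fderiv ℝ rs (x 1, x 2) (0, 1) ^ 2) = areaCoeff M a x := by
  have hxe := hIP.subset_exterior hx
  have h := hIP.eikonal_u x hx
  have hS := (Sigma_pos hM hxe).ne'
  have hD := (Delta_pos ha hxe).ne'
  simp only [gradPairing, metric_inv hM ha hxe, partialDeriv,
    fderiv_uFun (hIP.differentiableAt_rs hx), Fin.sum_univ_four, inverseMetric] at h
  simp at h
  field_simp at h
  linear_combination h

theorem orthogonal_eq :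
    Delta M a x * fderiv ℝ rs (x 1, x 2) (1, 0) * fderiv ℝ ths (x 1, x 2) (1, 0) +
      fderiv ℝ rs (x 1, x 2) (0, 1) * fderiv ℝ ths (x 1, x 2) (0, 1) = 0 := by
  have hxe := hIP.subset_exterior hx
  have h := hIP.orthogonal x hx
  have hS := (Sigma_pos hM hxe).ne'
  simp only [gradPairing, metric_inv hM ha hxe, partialDeriv,
    fderiv_comp_radius_angle (hIP.differentiableAt_rs hx),
    fderiv_comp_radius_angle (hIP.differentiableAt_ths hx), Fin.sum_univ_four, inverseMetric] at h
  simp at h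
  field_simp at h
  linear_combination h

/-- A vanishing determinant and the orthogonality of the two gradients would, through the eikonal
equation, force A ∂_θ θ_* = 0. -/
theorem jacobian_ne_zero :
    fderiv ℝ rs (x 1, x 2) (1, 0) * fderiv ℝ ths (x 1, x 2) (0, 1) -
      fderiv ℝ rs (x 1, x 2) (0, 1) * fderiv ℝ ths (x 1, x 2) (1, 0) ≠ 0 := by
  have hxe := hIP.subset_exterior hx
  have hA := (areaCoeff_pos hM ha hxe).ne'
  have h1 := hIP.eikonal_eq hM ha hx
  have h2 := hIP.orthogonal_eq hM ha hx
  have h3 := hIP.nondegenerate _ hx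
  intro h0
  apply mul_ne_zero hA h3
  rw [← h1]
  linear_combination Delta M a x * (Delta M a x * fderiv ℝ rs (x 1, x 2) (1, 0)) * h0 +
    Delta M a x * fderiv ℝ rs (x 1, x 2) (0, 1) * h2

theorem coordVec_ipCoord_eq {i : Fin 4} {v : Vec}
    (hv : fderiv ℝ (ipCoord rs ths) x v = Pi.single i 1) : coordVec (ipCoord rs ths) i x = v := by
  have hrs := hIP.differentiableAt_rs hx
  have hths := hIP.differentiableAt_ths hx
  refine coordVec_eq (differentiableAt_ipCoord hrs hths).hasFDerivAt (fun w hw => ?_) hv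
  have hJ := hIP.jacobian_ne_zero hM ha hx
  rw [fderiv_ipCoord hrs hths] at hw
  have e0 := congrFun hw 0
  have e1 := congrFun hw 1
  have e2 := congrFun hw 2
  have e3 := congrFun hw 3
  simp at e0 e1 e2 e3
  have f0 : w 0 = 0 := by linarith
  -- Cramer's rule for the (r, θ) block.
  have f1 : w 1 = 0 := by
    refine (mul_eq_zero.1 ?_).resolve_right hJ
    linear_combination fderiv ℝ ths (x 1, x 2) (0, 1) * (e1 - f0) -
      fderiv ℝ rs (x 1, x 2) (0, 1) * e2
  have f2 : w 2 = 0 := by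
    refine (mul_eq_zero.1 ?_).resolve_right hJ
    linear_combination fderiv ℝ rs (x 1, x 2) (1, 0) * e2 -
      fderiv ℝ ths (x 1, x 2) (1, 0) * (e1 - f0)
  ext k
  fin_cases k
  · exact f0
  · exact f1
  · exact f2
  · exact e3

theorem coordVec_phi : coordVec (ipCoord rs ths) 3 x = ![0, 0, 0, 1] := by
  refine hIP.coordVec_ipCoord_eq hM ha hx ?_
  rw [fderiv_ipCoord (hIP.differentiableAt_rs hx) (hIP.differentiableAt_ths hx)]
  ext k
  fin_cases k <;> simp

/-- The r and θ components, and hence the normalisation of e_λ, never enter the argument. -/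
theorem coordVec_thetaStar : coordVec (ipCoord rs ths) 2 x 0 = 0 ∧
    coordVec (ipCoord rs ths) 2 x 3 = 0 := by
  have hJ := hIP.jacobian_ne_zero hM ha hx
  have h := fderiv_ipCoord (hIP.differentiableAt_rs hx) (hIP.differentiableAt_ths hx)
  set α := fderiv ℝ rs (x 1, x 2) (1, 0)
  set β := fderiv ℝ rs (x 1, x 2) (0, 1)
  set γ := fderiv ℝ ths (x 1, x 2) (1, 0)
  set δ := fderiv ℝ ths (x 1, x 2) (0, 1)
  have : coordVec (ipCoord rs ths) 2 x =
      ![0, -β / (α * δ - β * γ), α / (α * δ - β * γ), 0] := by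
    refine hIP.coordVec_ipCoord_eq hM ha hx ?_
    rw [h]
    ext k
    fin_cases k <;> simp <;> field_simp <;> ring
  rw [this]
  exact ⟨rfl, rfl⟩

/-- The eikonal equation as |grad r_*|² = Ω⁻². With `gradRs_ths` it identifies Ω² grad r_* as
∂_{r_*} at constant t, θ_*, φ. -/
theorem gradRs_rs : (gradRs M a rs x 1 * fderiv ℝ rs (x 1, x 2) (1, 0) +
    gradRs M a rs x 2 * fderiv ℝ rs (x 1, x 2) (0, 1)) * Omega M a x ^ 2 = 1 := by
  have hxe := hIP.subset_exterior hx
  have hS := (Sigma_pos hM hxe).ne'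
  have hA := (areaCoeff_pos hM ha hxe).ne'
  rw [Omega_sq hM ha hxe]
  simp [gradRs]
  field_simp
  linear_combination hIP.eikonal_eq hM ha hx

theorem gradRs_ths : gradRs M a rs x 1 * fderiv ℝ ths (x 1, x 2) (1, 0) +
    gradRs M a rs x 2 * fderiv ℝ ths (x 1, x 2) (0, 1) = 0 := by
  have hxe := hIP.subset_exterior hx
  have hS := (Sigma_pos hM hxe).ne'
  simp [gradRs]
  field_simp
  linear_combination hIP.orthogonal_eq hM ha hx

/-- As t = u + u̲ and r_* = u̲ - u, the field ∂_u is ∂_t - ∂_{r_*}. -/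
theorem coordVec_u : coordVec (ipCoord rs ths) 0 x =
    ![1, 0, 0, 0] + -(Omega M a x ^ 2 • gradRs M a rs x) := by
  have h1 := hIP.gradRs_rs hM ha hx
  have h2 := hIP.gradRs_ths hM ha hx
  refine hIP.coordVec_ipCoord_eq hM ha hx ?_
  rw [fderiv_ipCoord (hIP.differentiableAt_rs hx) (hIP.differentiableAt_ths hx)]
  have g0 : gradRs M a rs x 0 = 0 := rfl
  have g3 : gradRs M a rs x 3 = 0 := rfl
  ext k
  fin_cases k <;> simp [g0, g3]
  · linear_combination h1 / 2
  · linear_combination -h1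
  · linear_combination -Omega M a x ^ 2 * h2

theorem coordVec_ub : coordVec (ipCoord rs ths) 1 x =
    ![1, 0, 0, 0] + Omega M a x ^ 2 • gradRs M a rs x := by
  have h1 := hIP.gradRs_rs hM ha hx
  have h2 := hIP.gradRs_ths hM ha hx
  refine hIP.coordVec_ipCoord_eq hM ha hx ?_
  rw [fderiv_ipCoord (hIP.differentiableAt_rs hx) (hIP.differentiableAt_ths hx)]
  have g0 : gradRs M a rs x 0 = 0 := rfl
  have g3 : gradRs M a rs x 3 = 0 := rfl
  ext k
  fin_cases k <;> simp [g0, g3]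
  · linear_combination -h1
  · linear_combination h1 / 2
  · linear_combination Omega M a x ^ 2 * h2

end IsIsraelPretorius

/-! ### The null frame through the orthonormal pair T, n -/

/-- The unit normal of the slices `t = const`. -/
noncomputable def unitNormal (M a : ℝ) (x : Vec) : Vec := (Omega M a x)⁻¹ • staticField M a x

/-- The unit vector in the direction of the gradient of `r_*`. -/
noncomputable def radialNormal (M a : ℝ) (rs : ℝ × ℝ → ℝ) (x : Vec) : Vec :=
  Omega M a x • gradRs M a rs x

namespace IsIsraelPretorius

variable (hIP : IsIsraelPretorius M a U rs ths) (hM : 0 < M) (ha : |a| ≤ M)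
  (hx : (x 1, x 2) ∈ U)

include hIP hx hM ha

theorem e4_eq : e4 M a rs ths x = unitNormal M a x + radialNormal M a rs x := by
  have hΩ := (Omega_pos hM ha (hIP.subset_exterior hx)).ne'
  rw [e4, hIP.coordVec_ub hM ha hx, hIP.coordVec_phi hM ha hx, unitNormal, radialNormal,
    staticField]
  ext k
  fin_cases k <;> simp [gradRs] <;> field_simp

theorem e3_eq : e3 M a rs ths x = unitNormal M a x + -radialNormal M a rs x := by
  have hΩ := (Omega_pos hM ha (hIP.subset_exterior hx)).ne'
  rw [e3, hIP.coordVec_u hM ha hx, hIP.coordVec_phi hM ha hx, unitNormal, radialNormal,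
    staticField]
  ext k
  fin_cases k <;> simp [gradRs] <;> field_simp

theorem pairing_unitNormal_self :
    pairing (metric M a) x (unitNormal M a x) (unitNormal M a x) = -1 := by
  have hxe := hIP.subset_exterior hx
  have hΩ := (Omega_pos hM ha hxe).ne'
  rw [unitNormal, pairing_smul_left, pairing_smul_right _ _ _ _ (metric_isSymm M a x),
    pairing_staticField_self hM ha hxe]
  field_simp

theorem pairing_unitNormal_radialNormal :
    pairing (metric M a) x (unitNormal M a x) (radialNormal M a rs x) = 0 := by
  rw [unitNormal, pairing_smul_left, pairing_staticField hM ha (hIP.subset_exterior hx), mul_zero]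
  simp [radialNormal, gradRs]

theorem pairing_radialNormal_self :
    pairing (metric M a) x (radialNormal M a rs x) (radialNormal M a rs x) = 1 := by
  have hxe := hIP.subset_exterior hx
  have hS := (Sigma_pos hM hxe).ne'
  have hD := (Delta_pos ha hxe).ne'
  rw [radialNormal, pairing_smul_left, pairing_smul_right _ _ _ _ (metric_isSymm M a x),
    ← hIP.gradRs_rs hM ha hx]
  simp [pairing, Fin.sum_univ_four, gradRs, metric]
  field_simp

theorem differentiableAt_unitNormal : DifferentiableAt ℝ (unitNormal M a) x := by
  have hxe := hIP.subset_exterior hx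
  exact ((differentiableAt_Omega hM ha hxe).fun_inv (Omega_pos hM ha hxe).ne').smul
    (differentiableAt_staticField hM ha hxe)

/-- The components contain first derivatives of r_*, so this is where its C² regularity is used. -/
theorem differentiableAt_radialNormal : DifferentiableAt ℝ (radialNormal M a rs) x := by
  have hxe := hIP.subset_exterior hx
  have hS := (Sigma_pos hM hxe).ne'
  have dS := differentiable_Sigma a
  have dD := differentiable_Delta M a
  have d1 := hIP.differentiableAt_fderiv_rs hx (1, 0)
  have d2 := hIP.differentiableAt_fderiv_rs hx (0, 1)
  refine (differentiableAt_Omega hM ha hxe).smul (differentiableAt_pi.2 fun k => ?_)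
  fin_cases k <;> (simp [gradRs]; try fun_prop (disch := assumption))

/-- The derivative of Ω⁻¹ multiplies a field orthogonal to `Z`, so the lapse enters only as a
factor. -/
theorem pairing_covDeriv_unitNormal {X : Vec → Vec} {Z : Vec} (hX : X x 0 = 0) (hZ : Z 0 = 0) :
    pairing (metric M a) x (covDeriv (metric M a) X (unitNormal M a) x) Z =
      (Omega M a x)⁻¹ * ((1 / 2) * (bigR M a x * Real.sin (x 2)) ^ 2 *
        (dirDeriv (X x) (omegaB M a) x * Z 3 + dirDeriv Z (omegaB M a) x * X x 3)) := by
  have hxe := hIP.subset_exterior hx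
  have h : unitNormal M a = (fun y => (Omega M a y)⁻¹) • staticField M a := rfl
  rw [h, covDeriv_smul_right _ _
    ((differentiableAt_Omega hM ha hxe).fun_inv (Omega_pos hM ha hxe).ne')
    (differentiableAt_staticField hM ha hxe), pairing_add_left, pairing_smul_left,
    pairing_smul_left, pairing_staticField hM ha hxe hZ, mul_zero, zero_add,
    pairing_covDeriv_staticField hM ha hxe hX hZ, metric_three_three hM ha hxe]

theorem eS_zero_component (b : Fin 2) : eS M a rs ths b x 0 = 0 := by
  rw [eS]
  split_ifs
  · rw [Pi.smul_apply, (hIP.coordVec_thetaStar hM ha hx).1, smul_zero]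
  · rw [Pi.smul_apply, hIP.coordVec_phi hM ha hx]; simp

theorem eS_lambda_phi : eS M a rs ths 0 x 3 = 0 := by
  rw [eS, if_pos rfl, Pi.smul_apply, (hIP.coordVec_thetaStar hM ha hx).2, smul_zero]

theorem eS_phi : eS M a rs ths 1 x = ![0, 0, 0, (bigR M a x * Real.sin (x 2))⁻¹] := by
  rw [eS, if_neg one_ne_zero, hIP.coordVec_phi hM ha hx]
  ext k
  fin_cases k <;> simp

theorem dirDeriv_eS_phi_omegaB : dirDeriv (eS M a rs ths 1 x) (omegaB M a) x = 0 := by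
  rw [hIP.eS_phi hM ha hx]
  exact dirDeriv_eq_zero_of_forall (omegaB_congr M a) rfl rfl

/-- `Δ ∂_r r_* = Q`. -/
theorem Delta_mul_fderiv_rs : Delta M a x * fderiv ℝ rs (x 1, x 2) (1, 0) = bigQ M a ths x := by
  have hD := Delta_pos ha (hIP.subset_exterior hx)
  have hr := hIP.rs_increasing _ hx
  -- Inserting the separation condition into the eikonal equation gives the square of the identity;
  -- monotonicity of r_* in r selects the positive root.
  refine (Real.sqrt_eq_iff_eq_sq ?_ (mul_pos hD hr).le).2 ?_ |>.symm <;>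
    have h1 := hIP.eikonal_eq hM ha hx <;> rw [areaCoeff, hIP.separation _ hx] at h1
  · nlinarith [sq_nonneg (Delta M a x * fderiv ℝ rs (x 1, x 2) (1, 0))]
  · linear_combination -h1

/-- The gradient of r_* annihilates θ_* and has no t or φ component, so it is ∂_r at constant θ_*
times its own r component, which is Q/Σ. -/
theorem dirDeriv_gradRs_omegaB : dirDeriv (gradRs M a rs x) (omegaB M a) x =
    bigQ M a ths x / Sigma a x * omegaBr M a ths x := by
  have hδ := hIP.nondegenerate _ hx
  obtain ⟨hd, hf⟩ := fderiv_radialCoord (hIP.differentiableAt_ths hx)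
  have hS := (Sigma_pos hM (hIP.subset_exterior hx)).ne'
  have ho := hIP.orthogonal_eq hM ha hx
  have hW : coordVec (radialCoord ths) 1 x =
      ![0, 1, -fderiv ℝ ths (x 1, x 2) (1, 0) / fderiv ℝ ths (x 1, x 2) (0, 1), 0] := by
    refine coordVec_eq hd.hasFDerivAt (fun w hw => ?_) ?_
    · rw [hf] at hw
      have f0 := congrFun hw 0
      have f1 := congrFun hw 1
      have f2 := congrFun hw 2
      have f3 := congrFun hw 3
      simp at f0 f1 f2 f3
      rw [f1, zero_mul, zero_add] at f2
      ext k
      fin_cases k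
      · exact f0
      · exact f1
      · exact (mul_eq_zero.1 f2).resolve_right hδ
      · exact f3
    · rw [hf]
      ext k
      fin_cases k <;> simp
      field_simp
      ring
  have hG : gradRs M a rs x = (bigQ M a ths x / Sigma a x) • coordVec (radialCoord ths) 1 x := by
    rw [hW, ← hIP.Delta_mul_fderiv_rs hM ha hx]
    ext k
    fin_cases k <;> simp [gradRs] <;> field_simp
    linear_combination ho
  rw [omegaBr, hG, dirDeriv, map_smul, smul_eq_mul, dirDeriv]

end IsIsraelPretorius

end IsraelPretorius

end Kerr

theorem mainTheorem7 (M a : ℝ) (hM : 0 < M) (ha : |a| ≤ M)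
    (U : Set (ℝ × ℝ)) (rs ths : ℝ × ℝ → ℝ) (hIP : Kerr.IsIsraelPretorius M a U rs ths)
    (x : Kerr.Vec) (hx : (x 1, x 2) ∈ U) :
    (∀ b c : Fin 2,
      Kerr.Omega M a x * (Kerr.chi M a rs ths b c x + Kerr.chib M a rs ths b c x) =
        Kerr.dirDeriv (Kerr.eS M a rs ths 0 x) (Kerr.omegaB M a) x
          * Kerr.bigR M a x * Real.sin (x 2)
          * (Kerr.kron c 1 * Kerr.kron b 0 + Kerr.kron b 1 * Kerr.kron c 0)) ∧
    (∀ b : Fin 2,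
      Kerr.zeta M a rs ths b x =
        -(Kerr.bigQ M a ths x * Kerr.bigR M a x * Real.sin (x 2) / (2 * Kerr.Sigma a x))
          * Kerr.omegaBr M a ths x * Kerr.kron b 1) ∧
    Kerr.omega M a rs ths x + Kerr.omegab M a rs ths x = 0 ∧
    Kerr.trChi M a rs ths x + Kerr.trChib M a rs ths x = 0 := by
  open Kerr in
  have hxe := hIP.subset_exterior hx
  have hΩ := (Omega_pos hM ha hxe).ne'
  have hR := (bigR_pos hM ha hxe).ne'
  have hs := (sin_theta_pos hxe).ne'
  have hS := (Sigma_pos hM hxe).ne'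
  have near := eventually_mem_of_isOpen hIP.isOpen hx
  have dT := hIP.differentiableAt_unitNormal hM ha hx
  have dn := hIP.differentiableAt_radialNormal hM ha hx
  have h3 : e3 M a rs ths =ᶠ[nhds x] unitNormal M a + -radialNormal M a rs :=
    near.mono fun y hy => hIP.e3_eq hM ha hy
  have h4 : e4 M a rs ths =ᶠ[nhds x] unitNormal M a + radialNormal M a rs :=
    near.mono fun y hy => hIP.e4_eq hM ha hy
  have hTT := near.mono fun y hy => hIP.pairing_unitNormal_self hM ha hy
  have hnn := near.mono fun y hy => hIP.pairing_radialNormal_self hM ha hy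
  have hTn := near.mono fun y hy => hIP.pairing_unitNormal_radialNormal hM ha hy
  have hdet := isUnit_det_metric hM ha hxe
  have hgd := differentiableAt_metric hM ha hxe
  have e0 := hIP.eS_zero_component hM ha hx
  have n0 : radialNormal M a rs x 0 = 0 := by simp [radialNormal, gradRs]
  have n3 : radialNormal M a rs x 3 = 0 := by simp [radialNormal, gradRs]
  have el := hIP.eS_lambda_phi hM ha hx
  have ep : eS M a rs ths 1 x 3 = (bigR M a x * Real.sin (x 2))⁻¹ := by
    rw [hIP.eS_phi hM ha hx]; rfl
  have hpω := hIP.dirDeriv_eS_phi_omegaB hM ha hx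
  have hχ : ∀ b c : Fin 2, Omega M a x * (chi M a rs ths b c x + chib M a rs ths b c x) =
      dirDeriv (eS M a rs ths 0 x) (omegaB M a) x * bigR M a x * Real.sin (x 2)
        * (kron c 1 * kron b 0 + kron b 1 * kron c 0) := by
    intro b c
    rw [chi, chib, nullForm_add_nullForm _ _ dT dn h3 h4,
      hIP.pairing_covDeriv_unitNormal hM ha hx (e0 b) (e0 c)]
    -- The λλ entry vanishes because e_λ has no φ component, the φφ entry because e_φ(ω_B) = 0.
    fin_cases b <;> fin_cases c <;> simp [kron, el, ep, hpω] <;> field_simp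
  refine ⟨hχ, fun b => ?_, ?_, ?_⟩
  · have hn : dirDeriv (radialNormal M a rs x) (omegaB M a) x =
        Omega M a x * (bigQ M a ths x / Sigma a x * omegaBr M a ths x) := by
      rw [← hIP.dirDeriv_gradRs_omegaB hM ha hx, radialNormal, dirDeriv, map_smul, smul_eq_mul,
        dirDeriv]
    rw [zeta, torsion_eq_neg_pairing (metric_isSymm M a) hdet hgd _ dT dn h3 h4 hTT hnn hTn,
      hIP.pairing_covDeriv_unitNormal hM ha hx (e0 b) n0, hn, n3]
    fin_cases b <;> simp [kron, el, ep]
    field_simp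
  · rw [omega, omegab,
      nullLapse_add_nullLapse (metric_isSymm M a) hdet hgd dT dn h3 h4 hTT hnn hTn,
      hIP.pairing_covDeriv_unitNormal hM ha hx n0 n0, n3]
    simp
  -- The traces involve only the diagonal entries of χ + χ̲, which were just found to vanish.
  · refine (mul_eq_zero.1 ?_).resolve_left hΩ
    have h0 := hχ 0 0
    have h1 := hχ 1 1
    simp [kron, hΩ] at h0 h1
    simp only [trChi, trChib, Fin.sum_univ_two]
    linear_combination Omega M a x * (h0 + h1)
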